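/- Let $a,b,g,h:[0,+\infty)\to\mathbb R$ be Lebesgue measurable functions such that: (a1) $a$ is bounded and $b$ is essentially bounded on $[0,+\infty)$; (a2) for some $t_1\ge 0$ and $a_0<1$, $|a(t)|\le a_0$ for almost all $t\ge t_1$; (a3)–(a4) $g(t)\le t$ and $h(t)\le t$ for $t\ge 0$, $g(t)\to+\infty$ and $h(t)\to+\infty$ as $t\to+\infty$, and $g^{-1}(U)$, $h^{-1}(U)$ are Lebesgue null sets whenever $U\subset\mathbb R$ is one. Suppose that $b(t)\ge b_0$ for almost all $t\ge 0$, with a constant $b_0>0$, and that there are $t_*\ge t_1$, $\delta>0$, $\tau>0$ such that (a6) $t-g(t)\le\delta$ and $t-h(t)\le\tau$ for all $t\ge t_*$. Write $\|f\|=\operatorname{ess\,sup}_{t\ge t_*}|f(t)|$ and $u^+=\max\{u,0\}$, and suppose that at least one of the following conditions holds: $$\text{(a)}\quad \left\|\frac{b-\beta}{\beta}\right\|+\left\|\frac b\beta\right\|\frac{\|a\|}{1-\|a\|}<1,\qquad\text{where }\beta(t)=\min\Bigl\{b(t),\frac1{\tau e}\Bigr\};$$ $$\text{(b)}\quad \|b\|\,\left\|\Bigl(t-h(t)-\frac1{\|b\|e}\Bigr)^+\right\|<1-2\|a\|.$$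 Then the neutral equation $(x(t)-a(t)x(g(t)))'=-b(t)x(h(t))$ is (uniformly) exponentially stable: there are $M>0$ and $\gamma>0$ such that, for every initial time $t_0\ge t_1$ and every bounded Borel measurable $\varphi:(-\infty,t_0]\to\mathbb R$, each solution $x$ of the equation on $[t_0,+\infty)$ with $x(t)=\varphi(t)$ for $t\le t_0$ satisfies $$|x(t)|\le M e^{-\gamma(t-t_0)}\sup_{r\le t_0}|\varphi(r)|\qquad\text{for almost all } t\ge t_0 .$$ Here a solution is a Lebesgue measurable function $x:\mathbb R\to\mathbb R$, locally essentially bounded on $[0,+\infty)$, for which there is a function $y$, locally absolutely continuous on $[t_0,+\infty)$, with $y(t_0)=x(t_0)-a(t_0)x(g(t_0))$ and, for almost all $t\ge t_0$, $y(t)=x(t)-a(t)x(g(t))$ and $y'(t)=-b(t)x(h(t))$. -/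

import Mathlib

open MeasureTheory Set Filter

noncomputable section

/-- `‖f‖_{[t₀, ∞)}`, the essential supremum of `|f|` on `[t₀, ∞)`
(with respect to Lebesgue measure). -/
def supNormFrom (t₀ : ℝ) (f : ℝ → ℝ) : ℝ :=
  (eLpNorm f ⊤ (volume.restrict (Ici t₀))).toReal

/-- Assumptions on a delayed argument `g : [0, ∞) → ℝ`: it is Lebesgue measurable, `g t ≤ t`,
`g t → +∞` as `t → +∞`, and preimages of null sets are null sets. -/
structure IsDelayedArgument (g : ℝ → ℝ) : Prop where
  aemeasurable : AEMeasurable g (volume.restrict (Ici 0))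
  le_self : ∀ t, 0 ≤ t → g t ≤ t
  tendsto_atTop : Tendsto g atTop atTop
  null_preimage : ∀ U : Set ℝ, volume U = 0 → volume (g ⁻¹' U ∩ Ici 0) = 0

/-- Admissible initial functions on `(-∞, t₀]`: Borel measurable and bounded. -/
structure IsInitialFunction (t₀ : ℝ) (φ : ℝ → ℝ) : Prop where
  measurable : Measurable (fun r : Iic t₀ => φ r)
  bounded : ∃ K : ℝ, ∀ t ≤ t₀, |φ t| ≤ K

/-- `x` is a solution of the initial value problem
`(x(t) - a(t) x(g(t)))' + b(t) x(h(t)) = 0` for `t ≥ t₀`, `x(t) = φ(t)` for `t ≤ t₀`.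
The neutral part `x(t) - a(t) x(g(t))` agrees almost everywhere on `[t₀, ∞)`, and at the initial
point `t₀`, with a locally absolutely continuous function, and the equation holds almost
everywhere. -/
structure IsNeutralSolution (a b g h : ℝ → ℝ) (t₀ : ℝ) (φ x : ℝ → ℝ) : Prop where
  aemeasurable : AEMeasurable x volume
  locally_bounded : ∀ T : ℝ, ∃ C : ℝ, ∀ᵐ t ∂(volume.restrict (Icc 0 T)), |x t| ≤ C
  equation : ∃ y : ℝ → ℝ,
    (∀ T, t₀ ≤ T → AbsolutelyContinuousOnInterval y t₀ T) ∧
    y t₀ = x t₀ - a t₀ * x (g t₀) ∧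
    (∀ᵐ t ∂(volume.restrict (Ici t₀)), y t = x t - a t * x (g t)) ∧
    (∀ᵐ t ∂(volume.restrict (Ici t₀)), HasDerivAt y (-(b t * x (h t))) t)
  initial : ∀ t ≤ t₀, x t = φ t

/-- Uniform exponential stability of `(x(t) - a(t) x(g(t)))' = -b(t) x(h(t))`, with initial times
ranging over `[t₁, ∞)`: the constants `M`, `γ` depend neither on the initial time `t₀` nor on the
initial function `φ`.  Solutions are determined only up to null sets, so the estimate is
for almost every `t ≥ t₀`. -/
def IsExponentiallyStableFrom (a b g h : ℝ → ℝ) (t₁ : ℝ) : Prop :=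
  ∃ M γ : ℝ, 0 < M ∧ 0 < γ ∧
    ∀ t₀, t₁ ≤ t₀ → ∀ φ x : ℝ → ℝ, IsInitialFunction t₀ φ →
      IsNeutralSolution a b g h t₀ φ x →
      ∀ᵐ t ∂(volume.restrict (Ici t₀)),
        |x t| ≤ M * Real.exp (-γ * (t - t₀)) * ⨆ r : Iic t₀, |φ r|

end

/-! Substituting x(h) = y(h) + a(h) x(g(h)), the neutral part y = x - a x(g) satisfies a forced
delay equation y' + c y(r) = f. Under (a), c = β, r = h and f = -(b - β) y(h) - b a(h) x(g(h)).
Under (b), c = b, r = max(h, t - σ) with σ = 1/(‖b‖e), and f = b (y(r) - y(h)) - b a(h) x(g(h)).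
Both choices give c · (maximal delay) · e ≤ 1, the classical non-oscillation condition, and hence a
comparison principle (`delay_inequality_nonneg`): with a suitable history, |f| ≤ (c - γ) N
e^{-γ(t-s)} forces |y| ≤ N e^{-γ(t-s)}.

The rest is a small-gain argument in sup norms weighted by e^{γ(t-s)}
(`exists_exp_bound_of_perturbation`). There x is controlled by y with factor 1/(1 - ‖a‖e^{γδ}), and
f by x and y. At γ = 0 the total gain is the left side of (a), respectively (‖b‖κ + ‖a‖)/(1 - ‖a‖)
with κ the norm of the truncated delay, which is < 1 exactly under (b). By continuity the gain stays
admissible for some γ > 0. On bounded intervals finite bounds exist a priori, and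
`Filter.Eventually.le_div_of_contraction` replaces them by bounds independent of the interval. The
growth estimate `IsNeutralPart.growth_bound` bridges the bounded gap between the initial time and
the start of the decay estimate. -/

/-! ### Comparison principles for scalar delay inequalities -/

/-- An absolutely continuous function with a.e. nonnegative derivative does not decrease. -/
theorem AbsolutelyContinuousOnInterval.le_of_ae_deriv_nonneg {f : ℝ → ℝ} {a b : ℝ} (hab : a ≤ b)
    (hf : AbsolutelyContinuousOnInterval f a b)
    (h : ∀ᵐ t, a ≤ t → t ≤ b → ∃ d, HasDerivAt f d t ∧ 0 ≤ d) : f a ≤ f b := by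
  have h1 : 0 ≤ ∫ x in a..b, deriv f x := by
    refine intervalIntegral.integral_nonneg_of_ae_restrict hab ?_
    refine (ae_restrict_iff' measurableSet_Icc).2 ?_
    filter_upwards [h] with t ht hm
    obtain ⟨d, hd, h0⟩ := ht hm.1 hm.2
    simpa [hd.deriv] using h0
  rw [hf.integral_deriv_eq_sub] at h1
  linarith

theorem AbsolutelyContinuousOnInterval.mono_Icc {f : ℝ → ℝ} {a b c d : ℝ}
    (hf : AbsolutelyContinuousOnInterval f a b) (hac : a ≤ c) (hcd : c ≤ d) (hdb : d ≤ b) :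
    AbsolutelyContinuousOnInterval f c d := by
  refine hf.mono ?_
  rw [uIcc_of_le hcd, uIcc_of_le (hac.trans (hcd.trans hdb))]
  exact Icc_subset_Icc hac hdb

/-- An absolutely continuous function grows at most as much as a smooth function that
dominates its derivative. -/
theorem AbsolutelyContinuousOnInterval.abs_sub_le {f F F' : ℝ → ℝ} {a b : ℝ} (hab : a ≤ b)
    (hf : AbsolutelyContinuousOnInterval f a b) (hF : ContDiff ℝ 1 F)
    (hF' : ∀ t, HasDerivAt F (F' t) t)
    (h : ∀ᵐ t, a ≤ t → t ≤ b → ∃ d, HasDerivAt f d t ∧ |d| ≤ F' t) :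
    |f b - f a| ≤ F b - F a := by
  have hFac : AbsolutelyContinuousOnInterval F a b := hF.contDiffOn.absolutelyContinuousOnInterval
  rw [abs_sub_le_iff]
  constructor
  · have := (hFac.sub hf).le_of_ae_deriv_nonneg hab (by
      filter_upwards [h] with t ht h1 h2
      obtain ⟨d, hd, hb⟩ := ht h1 h2
      exact ⟨_, (hF' t).sub hd, by linarith [le_abs_self d]⟩)
    simp only [Pi.sub_apply] at this
    linarith
  · have := (hFac.add hf).le_of_ae_deriv_nonneg hab (by
      filter_upwards [h] with t ht h1 h2
      obtain ⟨d, hd, hb⟩ := ht h1 h2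
      exact ⟨_, (hF' t).add hd, by linarith [neg_abs_le d]⟩)
    simp only [Pi.add_apply] at this
    linarith

/-- If the derivative of `W` is bounded below by `l (W t - W u)` for some earlier `u`, then `W`
never falls below its initial value. -/
theorem AbsolutelyContinuousOnInterval.initial_le {W : ℝ → ℝ} {p T l : ℝ} (hl : 0 ≤ l)
    (hW : AbsolutelyContinuousOnInterval W p T)
    (h : ∀ᵐ t, p ≤ t → t ≤ T →
      ∃ d, HasDerivAt W d t ∧ ∃ u, p ≤ u ∧ u ≤ t ∧ l * (W t - W u) ≤ d)
    {t : ℝ} (hpt : p ≤ t) (htT : t ≤ T) : W p ≤ W t := by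
  have hW' := hW.mono_Icc le_rfl hpt htT
  have hcont : ContinuousOn W (Icc p t) := by
    simpa [uIcc_of_le hpt] using hW'.continuousOn
  -- On [m, t], e^{-lv} (W v - W m) is nondecreasing, because W u ≤ W m, and it vanishes at m. Hence
  -- W t ≥ W m ≥ W p.
  obtain ⟨m, hm, hmax⟩ := isCompact_Icc.exists_isMaxOn (nonempty_Icc.2 hpt) hcont
  have hmax' : ∀ u, p ≤ u → u ≤ t → W u ≤ W m := fun u h1 h2 => hmax ⟨h1, h2⟩
  have hE : ∀ v : ℝ, HasDerivAt (fun v => Real.exp (-l * v)) (Real.exp (-l * v) * (-l * 1)) v :=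
    fun v => ((hasDerivAt_id v).const_mul (-l)).exp
  have hEac : AbsolutelyContinuousOnInterval (fun v => Real.exp (-l * v)) m t := by
    refine ContDiffOn.absolutelyContinuousOnInterval (ContDiff.contDiffOn ?_)
    fun_prop
  have hC : AbsolutelyContinuousOnInterval (fun _ : ℝ => W m) m t :=
    contDiffOn_const.absolutelyContinuousOnInterval
  have := (hEac.mul ((hW'.mono_Icc hm.1 hm.2 le_rfl).sub hC)).le_of_ae_deriv_nonneg hm.2 (by
    filter_upwards [h] with v hv h1 h2
    obtain ⟨d, hd, u, hpu, huv, hb⟩ := hv (hm.1.trans h1) (h2.trans htT)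
    refine ⟨_, (hE v).mul (hd.sub_const (W m)), ?_⟩
    have h3 := hmax' u hpu (huv.trans h2)
    have : Real.exp (-l * v) * (-l * 1) * (W v - W m) + Real.exp (-l * v) * d
      = Real.exp (-l * v) * ((d - l * (W v - W u)) + l * (W m - W u)) := by ring
    simp only [Pi.sub_apply]
    rw [this]
    have := mul_nonneg hl (sub_nonneg.2 h3)
    exact mul_nonneg (Real.exp_pos _).le (by linarith))
  simp only [Pi.mul_apply, Pi.sub_apply, sub_self, mul_zero] at this
  have h4 := nonneg_of_mul_nonneg_right this (Real.exp_pos _)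
  linarith [hmax' p le_rfl hpt]

/-- Positivity for the delay inequality `z' + c z(r) ≥ 0` with delay at most `σ` and
`c e^{lσ} ≤ l`. -/
theorem delay_inequality_nonneg {z r c : ℝ → ℝ} {s T l σ : ℝ} (hl : 0 ≤ l)
    (hz : AbsolutelyContinuousOnInterval z (s - σ) T) (hz0 : 0 ≤ z (s - σ))
    (hhist : ∀ᵐ t, s - σ ≤ t → t ≤ s → ∃ d, HasDerivAt z d t ∧ 0 ≤ d + l * z t)
    (heq : ∀ᵐ t, s ≤ t → t ≤ T → ∃ d, HasDerivAt z d t ∧ t - σ ≤ r t ∧ r t ≤ t ∧ 0 ≤ c t ∧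
      c t * Real.exp (l * σ) ≤ l ∧ 0 ≤ d + c t * z (r t))
    {t : ℝ} (hst : s - σ ≤ t) (htT : t ≤ T) : 0 ≤ z t := by
  have hE : ∀ v : ℝ, HasDerivAt (fun v => Real.exp (l * v)) (Real.exp (l * v) * (l * 1)) v :=
    fun v => ((hasDerivAt_id v).const_mul l).exp
  have hEac : AbsolutelyContinuousOnInterval (fun v => Real.exp (l * v)) (s - σ) T := by
    refine ContDiffOn.absolutelyContinuousOnInterval (ContDiff.contDiffOn ?_)
    fun_prop
  -- For W = e^{lt} z the term l z in W' turns the inequality into W' ≥ l (W t - W u).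
  have := (hEac.mul hz).initial_le hl (by
    filter_upwards [hhist, heq] with v h1 h2 hv1 hv2
    rcases le_total v s with hvs | hvs
    · obtain ⟨d, hd, hb⟩ := h1 hv1 hvs
      refine ⟨_, (hE v).mul hd, v, hv1, le_rfl, ?_⟩
      have := mul_nonneg (Real.exp_pos (l * v)).le hb
      simp only [sub_self, mul_zero]
      linarith
    · obtain ⟨d, hd, hr1, hr2, hc0, hc, hb⟩ := h2 hvs hv2
      have hev := Real.exp_pos (l * v)
      have hexp : Real.exp (l * v) * c v * Real.exp (l * (r v - v)) ≤
          Real.exp (l * v) * c v := by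
        have : Real.exp (l * (r v - v)) ≤ 1 :=
          Real.exp_le_one_iff.2 (mul_nonpos_of_nonneg_of_nonpos hl (by linarith))
        exact mul_le_of_le_one_right (by positivity) this
      have hval : Real.exp (l * v) * c v ≤ l * Real.exp (l * r v) := by
        have h3 : Real.exp (l * v) ≤ Real.exp (l * σ) * Real.exp (l * r v) := by
          rw [← Real.exp_add]
          refine Real.exp_le_exp.2 ?_
          nlinarith
        calc Real.exp (l * v) * c v ≤ (Real.exp (l * σ) * Real.exp (l * r v)) * c v := by gcongr
          _ = (c v * Real.exp (l * σ)) * Real.exp (l * r v) := by ring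
          _ ≤ _ := by gcongr
      have hb' := mul_nonneg hev.le hb
      -- If z(r) ≥ 0, take u = r: the bound on c gives e^{lv} c z(r) ≤ l W(r). If z(r) < 0, the
      -- delayed term already helps, and the left endpoint, where W ≥ 0, serves as u.
      rcases le_total 0 (z (r v)) with hzr | hzr
      · refine ⟨_, (hE v).mul hd, r v, by linarith, hr2, ?_⟩
        have := mul_le_mul_of_nonneg_right hval hzr
        simp only [Pi.mul_apply]
        linarith
      · refine ⟨_, (hE v).mul hd, s - σ, le_rfl, hv1, ?_⟩
        have h5 : 0 ≤ l * (Real.exp (l * (s - σ)) * z (s - σ)) := by positivity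
        have h6 : Real.exp (l * v) * (c v * z (r v)) ≤ 0 :=
          mul_nonpos_of_nonneg_of_nonpos hev.le (mul_nonpos_of_nonneg_of_nonpos hc0 hzr)
        simp only [Pi.mul_apply]
        linarith) hst htT
  simp only [Pi.mul_apply] at this
  have h4 : 0 ≤ Real.exp (l * t) * z t := le_trans (by positivity) this
  exact nonneg_of_mul_nonneg_right h4 (Real.exp_pos _)

/-- Positivity is applied to z = N e^{-γ(t-s)} - y. The exponential is decreasing, so its value at r
t is at least that at t, and it is a supersolution with margin (c - γ) N e^{-γ(t-s)}, which absorbs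
the forcing. -/
theorem delay_equation_le_exp {y r c : ℝ → ℝ} {s T l σ γ N : ℝ} (hl : 0 ≤ l) (hσ : 0 ≤ σ)
    (hγ : 0 ≤ γ) (hN : 0 ≤ N)
    (hy : AbsolutelyContinuousOnInterval y (s - σ) T) (hy0 : |y (s - σ)| ≤ N)
    (hhist : ∀ᵐ t, s - σ ≤ t → t ≤ s → ∃ d, HasDerivAt y d t ∧
      |d| + l * |y t| ≤ (l - γ) * (N * Real.exp (-γ * (t - s))))
    (heq : ∀ᵐ t, s ≤ t → t ≤ T → ∃ d, HasDerivAt y d t ∧ t - σ ≤ r t ∧ r t ≤ t ∧ 0 ≤ c t ∧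
      c t * Real.exp (l * σ) ≤ l ∧
      |d + c t * y (r t)| ≤ (c t - γ) * (N * Real.exp (-γ * (t - s))))
    {t : ℝ} (hst : s - σ ≤ t) (htT : t ≤ T) : y t ≤ N * Real.exp (-γ * (t - s)) := by
  have hE : ∀ v : ℝ, HasDerivAt (fun v => N * Real.exp (-γ * (v - s)))
      (N * (Real.exp (-γ * (v - s)) * (-γ * 1))) v :=
    fun v => ((((hasDerivAt_id v).sub_const s).const_mul (-γ)).exp).const_mul N
  have hEac : AbsolutelyContinuousOnInterval (fun v => N * Real.exp (-γ * (v - s))) (s - σ) T := by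
    refine ContDiffOn.absolutelyContinuousOnInterval (ContDiff.contDiffOn ?_)
    fun_prop
  have := delay_inequality_nonneg (r := r) (c := c) hl (hEac.sub hy) (by
      have h1 : 1 ≤ Real.exp (-γ * (s - σ - s)) := Real.one_le_exp (by nlinarith)
      have h2 := le_mul_of_one_le_right hN h1
      simp only [Pi.sub_apply]
      linarith [le_abs_self (y (s - σ))])
    (by
      filter_upwards [hhist] with v h1 hv1 hv2
      obtain ⟨d, hd, hb⟩ := h1 hv1 hv2
      refine ⟨_, (hE v).sub hd, ?_⟩
      have := mul_le_mul_of_nonneg_left (le_abs_self (y v)) hl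
      simp only [Pi.sub_apply]
      linarith [le_abs_self d])
    (by
      filter_upwards [heq] with v h1 hv1 hv2
      obtain ⟨d, hd, hr1, hr2, hc0, hc, hb⟩ := h1 hv1 hv2
      refine ⟨_, (hE v).sub hd, hr1, hr2, hc0, hc, ?_⟩
      have h3 : N * Real.exp (-γ * (v - s)) ≤ N * Real.exp (-γ * (r v - s)) := by
        refine mul_le_mul_of_nonneg_left (Real.exp_le_exp.2 ?_) hN
        nlinarith
      have h4 := mul_le_mul_of_nonneg_left h3 hc0
      simp only [Pi.sub_apply]
      linarith [le_abs_self (d + c v * y (r v))]) hst htT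
  simp only [Pi.sub_apply] at this
  linarith

/-- Exponential estimate for the perturbed non-oscillatory delay equation `y' + c y(r) = f`. -/
theorem delay_equation_abs_le_exp {y r c : ℝ → ℝ} {s T l σ γ N : ℝ} (hl : 0 ≤ l) (hσ : 0 ≤ σ)
    (hγ : 0 ≤ γ) (hN : 0 ≤ N)
    (hy : AbsolutelyContinuousOnInterval y (s - σ) T) (hy0 : |y (s - σ)| ≤ N)
    (hhist : ∀ᵐ t, s - σ ≤ t → t ≤ s → ∃ d, HasDerivAt y d t ∧
      |d| + l * |y t| ≤ (l - γ) * (N * Real.exp (-γ * (t - s))))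
    (heq : ∀ᵐ t, s ≤ t → t ≤ T → ∃ d, HasDerivAt y d t ∧ t - σ ≤ r t ∧ r t ≤ t ∧ 0 ≤ c t ∧
      c t * Real.exp (l * σ) ≤ l ∧
      |d + c t * y (r t)| ≤ (c t - γ) * (N * Real.exp (-γ * (t - s))))
    {t : ℝ} (hst : s - σ ≤ t) (htT : t ≤ T) : |y t| ≤ N * Real.exp (-γ * (t - s)) := by
  rw [abs_le']
  refine ⟨delay_equation_le_exp hl hσ hγ hN hy hy0 hhist heq hst htT, ?_⟩
  refine delay_equation_le_exp (y := -y) (r := r) (c := c) hl hσ hγ hN hy.neg (by simpa using hy0)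
    ?_ ?_ hst htT
  · filter_upwards [hhist] with v h1 hv1 hv2
    obtain ⟨d, hd, hb⟩ := h1 hv1 hv2
    exact ⟨-d, hd.neg, by simpa using hb⟩
  · filter_upwards [heq] with v h1 hv1 hv2
    obtain ⟨d, hd, hr1, hr2, hc0, hc, hb⟩ := h1 hv1 hv2
    refine ⟨-d, hd.neg, hr1, hr2, hc0, hc, ?_⟩
    rw [← abs_neg]
    convert hb using 2
    simp only [Pi.neg_apply]
    ring

/-! ### Self-improving bounds -/

/-- A self-improving eventual upper bound can be replaced by the fixed point of the
improvement. -/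
theorem Filter.Eventually.le_div_of_contraction {α : Type*} {L : Filter α}
    [CountableInterFilter L] {f : α → ℝ} {A q : ℝ} (hA : 0 ≤ A) (hq0 : 0 ≤ q) (hq : q < 1)
    (hbdd : ∃ N, ∀ᶠ t in L, f t ≤ N)
    (hstep : ∀ N, 0 ≤ N → (∀ᶠ t in L, f t ≤ N) → ∀ᶠ t in L, f t ≤ A + q * N) :
    ∀ᶠ t in L, f t ≤ A / (1 - q) := by
  obtain ⟨N, hN⟩ := hbdd
  have hq' : 0 < 1 - q := by linarith
  -- After k improvements the excess over the fixed point is at most q^k max(N, 0). Countably many k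
  -- can be intersected before letting k tend to infinity.
  have key : ∀ k : ℕ, ∀ᶠ t in L, f t ≤ A / (1 - q) + q ^ k * max N 0 := by
    intro k
    induction k with
    | zero =>
      filter_upwards [hN] with t ht
      have : 0 ≤ A / (1 - q) := by positivity
      simp only [pow_zero, one_mul]
      linarith [le_max_left N 0]
    | succ k ih =>
      filter_upwards [hstep _ (by positivity) ih] with t ht
      refine ht.trans (le_of_eq ?_)
      field_simp
      ring
  filter_upwards [eventually_countable_forall.2 key] with t ht
  have hlim : Tendsto (fun k : ℕ => A / (1 - q) + q ^ k * max N 0) atTop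
      (nhds (A / (1 - q) + 0 * max N 0)) :=
    ((tendsto_pow_atTop_nhds_zero_of_lt_one hq0 hq).mul_const _).const_add _
  rw [zero_mul, add_zero] at hlim
  exact ge_of_tendsto' hlim ht

/-! ### Essential bounds and composition with delays -/

theorem supNormFrom_le {f : ℝ → ℝ} {t₀ C : ℝ} (hC : 0 ≤ C)
    (h : ∀ᵐ t ∂(volume.restrict (Ici t₀)), |f t| ≤ C) : supNormFrom t₀ f ≤ C := by
  refine ENNReal.toReal_le_of_le_ofReal hC ?_
  rw [eLpNorm_exponent_top]
  exact eLpNormEssSup_le_of_ae_bound h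

theorem supNormFrom_nonneg (t₀ : ℝ) (f : ℝ → ℝ) : 0 ≤ supNormFrom t₀ f := ENNReal.toReal_nonneg

/-- Essential boundedness is needed because `toReal` sends an infinite essential supremum to 0. -/
theorem ae_abs_le_supNormFrom {f : ℝ → ℝ} {t₀ : ℝ}
    (h : ∃ C, ∀ᵐ t ∂(volume.restrict (Ici t₀)), |f t| ≤ C) :
    ∀ᵐ t, t₀ ≤ t → |f t| ≤ supNormFrom t₀ f := by
  obtain ⟨C, hC⟩ := h
  have hfin : eLpNorm f ⊤ (volume.restrict (Ici t₀)) ≠ ⊤ := by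
    rw [eLpNorm_exponent_top]
    exact (eLpNormEssSup_lt_top_of_ae_bound hC).ne
  refine (ae_restrict_iff' measurableSet_Ici).1 ?_
  filter_upwards [ae_le_eLpNormEssSup (f := f) (μ := volume.restrict (Ici t₀))] with t ht
  rw [← eLpNorm_exponent_top] at ht
  have := ENNReal.toReal_mono hfin ht
  simpa [supNormFrom] using this

/-- This is where null preimages enter: almost everywhere bounds on x and a survive composition with
g and h. -/
theorem IsDelayedArgument.ae_comp {g : ℝ → ℝ} (hg : IsDelayedArgument g) {P : ℝ → Prop}
    (hP : ∀ᵐ u, P u) : ∀ᵐ t, 0 ≤ t → P (g t) := by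
  have h0 := hg.null_preimage _ (ae_iff.1 hP)
  rw [ae_iff]
  refine measure_mono_null (fun t ht => ?_) h0
  simp only [mem_ofPred_eq, Classical.not_imp] at ht
  exact ⟨ht.2, ht.1⟩

theorem ae_of_ae_restrict_Ici {P : ℝ → Prop} {t₀ : ℝ}
    (h : ∀ᵐ t ∂(volume.restrict (Ici t₀)), P t) : ∀ᵐ t, t₀ ≤ t → P t :=
  (ae_restrict_iff' measurableSet_Ici).1 h

/-! ### The neutral part and a priori growth -/

/-- From time `s₀` on, `y` is the absolutely continuous neutral part `x - a x(g)` of `x`, and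
`y' = -b x(h)`. -/
structure IsNeutralPart (a b g h : ℝ → ℝ) (s₀ : ℝ) (x y : ℝ → ℝ) : Prop where
  locally_bounded : ∀ T : ℝ, ∃ C : ℝ, ∀ᵐ u, s₀ ≤ u → u ≤ T → |x u| ≤ C
  absolutelyContinuous : ∀ T, s₀ ≤ T → AbsolutelyContinuousOnInterval y s₀ T
  eq_sub : ∀ᵐ u, s₀ ≤ u → y u = x u - a u * x (g u)
  hasDerivAt : ∀ᵐ u, s₀ ≤ u → HasDerivAt y (-(b u * x (h u))) u

theorem IsNeutralPart.mono {a b g h : ℝ → ℝ} {s₀ s₁ : ℝ} {x y : ℝ → ℝ}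
    (hxy : IsNeutralPart a b g h s₀ x y) (hs : s₀ ≤ s₁) : IsNeutralPart a b g h s₁ x y where
  locally_bounded T := by
    obtain ⟨C, hC⟩ := hxy.locally_bounded T
    exact ⟨C, hC.mono fun u hu h1 => hu (hs.trans h1)⟩
  absolutelyContinuous T hT :=
    (hxy.absolutelyContinuous T (hs.trans hT)).mono_Icc hs hT le_rfl
  eq_sub := hxy.eq_sub.mono fun u hu h1 => hu (hs.trans h1)
  hasDerivAt := hxy.hasDerivAt.mono fun u hu h1 => hu (hs.trans h1)

theorem IsNeutralSolution.exists_neutralPart {a b g h : ℝ → ℝ} {t₀ : ℝ} {φ x : ℝ → ℝ}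
    (hx : IsNeutralSolution a b g h t₀ φ x) (ht₀ : 0 ≤ t₀) :
    ∃ y, IsNeutralPart a b g h t₀ x y ∧ y t₀ = x t₀ - a t₀ * x (g t₀) := by
  obtain ⟨y, h1, h2, h3, h4⟩ := hx.equation
  refine ⟨y, ⟨fun T => ?_, h1, ae_of_ae_restrict_Ici h3, ae_of_ae_restrict_Ici h4⟩, h2⟩
  obtain ⟨C, hC⟩ := hx.locally_bounded T
  refine ⟨C, ?_⟩
  filter_upwards [(ae_restrict_iff' measurableSet_Icc).1 hC] with u hu h1 h2
  exact hu ⟨ht₀.trans h1, h2⟩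

/-- A priori estimate: solutions grow at most exponentially, uniformly in the initial data. -/
theorem IsNeutralPart.growth_bound {a b g h x y : ℝ → ℝ} {t₀ A α B Γ Φ : ℝ}
    (hxy : IsNeutralPart a b g h t₀ x y) (hy0 : y t₀ = x t₀ - a t₀ * x (g t₀))
    (hg : IsDelayedArgument g) (hh : IsDelayedArgument h) (ht₀ : 0 ≤ t₀)
    (hA0 : 0 ≤ A) (hA : |a t₀| ≤ A) (hα0 : 0 ≤ α) (hα : ∀ᵐ u, t₀ ≤ u → |a u| ≤ α)
    (hB0 : 0 ≤ B) (hB : ∀ᵐ u, t₀ ≤ u → |b u| ≤ B)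
    (hΓ : 0 < Γ) (hq : B / Γ + α < 1) (hφ : ∀ u ≤ t₀, |x u| ≤ Φ) :
    (∀ t, t₀ ≤ t → |y t| ≤
      (1 + A + (1 + (1 + A + 1) / (1 - (B / Γ + α)))) * Φ * Real.exp (Γ * (t - t₀))) ∧
    ∀ᵐ t, t₀ ≤ t → |x t| ≤
      (1 + A + (1 + (1 + A + 1) / (1 - (B / Γ + α)))) * Φ * Real.exp (Γ * (t - t₀)) := by
  have hΦ : 0 ≤ Φ := (abs_nonneg _).trans (hφ t₀ le_rfl)
  set q := B / Γ + α with hqdef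
  have hBΓ : 0 ≤ B / Γ := by positivity
  have hq0 : 0 ≤ q := by positivity
  -- The pointwise bound A is used here: the almost everywhere bound α says nothing at the single
  -- point t₀.
  have hy0' : |y t₀| ≤ (1 + A) * Φ := by
    rw [hy0]
    calc |x t₀ - a t₀ * x (g t₀)| ≤ |x t₀| + |a t₀ * x (g t₀)| := abs_sub _ _
      _ = |x t₀| + |a t₀| * |x (g t₀)| := by rw [abs_mul]
      _ ≤ Φ + A * Φ := by
        gcongr
        · exact hφ _ le_rfl
        · exact hφ _ (hg.le_self _ ht₀)
      _ = _ := by ring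
  -- The later time t is quantified inside the almost everywhere statement, so that u can be
  -- replaced by g t or h t.
  have hpast : ∀ T N, 0 ≤ N → (∀ᵐ u, t₀ ≤ u → u ≤ T → |x u| ≤ N * Real.exp (Γ * (u - t₀))) →
      ∀ᵐ u, ∀ t, u ≤ t → t₀ ≤ t → t ≤ T → |x u| ≤ (Φ + N) * Real.exp (Γ * (t - t₀)) := by
    intro T N hN hx
    filter_upwards [hx] with u hu t hut ht1 ht2
    have h1 : 1 ≤ Real.exp (Γ * (t - t₀)) := Real.one_le_exp (by nlinarith)
    rcases le_total u t₀ with h2 | h2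
    · have := hφ u h2
      nlinarith
    · have h3 := hu h2 (hut.trans ht2)
      have h4 : Real.exp (Γ * (u - t₀)) ≤ Real.exp (Γ * (t - t₀)) :=
        Real.exp_le_exp.2 (by nlinarith)
      have := mul_le_mul_of_nonneg_left h4 hN
      nlinarith
  have hybound : ∀ T N, 0 ≤ N →
      (∀ᵐ u, t₀ ≤ u → u ≤ T → |x u| ≤ N * Real.exp (Γ * (u - t₀))) →
      ∀ t, t₀ ≤ t → t ≤ T →
        |y t| ≤ (1 + A) * Φ + B / Γ * (Φ + N) * Real.exp (Γ * (t - t₀)) := by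
    intro T N hN hx t ht1 ht2
    have hd : ∀ v, HasDerivAt (fun v => B / Γ * (Φ + N) * Real.exp (Γ * (v - t₀)))
        (B / Γ * (Φ + N) * (Real.exp (Γ * (v - t₀)) * (Γ * 1))) v := fun v =>
      ((((hasDerivAt_id v).sub_const t₀).const_mul Γ).exp).const_mul _
    have := (hxy.absolutelyContinuous t ht1).abs_sub_le ht1 (by fun_prop) hd (by
      filter_upwards [hxy.hasDerivAt, hh.ae_comp (hpast T N hN hx), hB] with u h1 h2 h3 hu1 hu2
      refine ⟨_, h1 hu1, ?_⟩
      rw [abs_neg, abs_mul]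
      calc |b u| * |x (h u)| ≤ B * ((Φ + N) * Real.exp (Γ * (u - t₀))) := by
            gcongr
            · exact h3 hu1
            · exact h2 (ht₀.trans hu1) u (hh.le_self _ (ht₀.trans hu1)) hu1 (hu2.trans ht2)
        _ = _ := by field_simp)
    have h5 : 0 ≤ B / Γ * (Φ + N) * Real.exp (Γ * (t₀ - t₀)) := by positivity
    have h6 := abs_sub_abs_le_abs_sub (y t) (y t₀)
    linarith
  have hxbound : ∀ T, ∀ᵐ u, t₀ ≤ u → u ≤ T →
      |x u| ≤ (1 + A + 1) * Φ / (1 - q) * Real.exp (Γ * (u - t₀)) := by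
    intro T
    -- In A, the part (1 + A)Φ bounds y at t₀; the additional Φ absorbs the contribution qΦ of the
    -- initial data.
    have key := Filter.Eventually.le_div_of_contraction
      (L := ae (volume.restrict (Icc t₀ T))) (f := fun u => |x u| * Real.exp (-(Γ * (u - t₀))))
      (A := (1 + A + 1) * Φ) (by positivity) hq0 hq (by
        obtain ⟨C, hC⟩ := hxy.locally_bounded T
        refine ⟨C, (ae_restrict_iff' measurableSet_Icc).2 ?_⟩
        filter_upwards [hC] with u hu hm
        refine le_trans ?_ (hu hm.1 hm.2)
        refine mul_le_of_le_one_right (abs_nonneg _) (Real.exp_le_one_iff.2 ?_)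
        have := mul_nonneg hΓ.le (sub_nonneg.2 hm.1)
        linarith)
      (by
        intro N hN hf
        have hx : ∀ᵐ u, t₀ ≤ u → u ≤ T → |x u| ≤ N * Real.exp (Γ * (u - t₀)) := by
          filter_upwards [(ae_restrict_iff' measurableSet_Icc).1 hf] with u hu h1 h2
          have := hu ⟨h1, h2⟩
          rwa [Real.exp_neg, ← div_eq_mul_inv, div_le_iff₀ (Real.exp_pos _)] at this
        refine (ae_restrict_iff' measurableSet_Icc).2 ?_
        filter_upwards [hxy.eq_sub, hg.ae_comp (hpast T N hN hx), hα] with u h1 h2 h3 hm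
        have hu0 := ht₀.trans hm.1
        rw [Real.exp_neg, ← div_eq_mul_inv, div_le_iff₀ (Real.exp_pos _)]
        have h4 := h2 hu0 u (hg.le_self _ hu0) hm.1 hm.2
        have h5 := hybound T N hN hx u hm.1 hm.2
        have h6 : |a u| * |x (g u)| ≤ α * ((Φ + N) * Real.exp (Γ * (u - t₀))) := by
          gcongr
          exact h3 hm.1
        have h7 : x u = y u + a u * x (g u) := by rw [h1 hm.1]; ring
        have h8 : |x u| ≤ |y u| + |a u| * |x (g u)| := by
          rw [h7, ← abs_mul]; exact abs_add_le _ _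
        have h9 : 1 ≤ Real.exp (Γ * (u - t₀)) :=
          Real.one_le_exp (mul_nonneg hΓ.le (sub_nonneg.2 hm.1))
        have h10 := le_mul_of_one_le_right (by positivity : 0 ≤ (1 + A) * Φ) h9
        have h11 : q * Φ ≤ 1 * Φ := mul_le_mul_of_nonneg_right hq.le hΦ
        have h12 := mul_le_mul_of_nonneg_right h11 (Real.exp_pos (Γ * (u - t₀))).le
        have h13 : ((1 + A + 1) * Φ + q * N) * Real.exp (Γ * (u - t₀)) =
          (1 + A) * Φ * Real.exp (Γ * (u - t₀)) + (1 * Φ * Real.exp (Γ * (u - t₀)))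
            + q * N * Real.exp (Γ * (u - t₀)) := by ring
        have h14 : B / Γ * (Φ + N) * Real.exp (Γ * (u - t₀)) +
          α * ((Φ + N) * Real.exp (Γ * (u - t₀))) = q * Φ * Real.exp (Γ * (u - t₀))
            + q * N * Real.exp (Γ * (u - t₀)) := by rw [hqdef]; ring
        linarith)
    filter_upwards [(ae_restrict_iff' measurableSet_Icc).1 key] with u hu h1 h2
    have := hu ⟨h1, h2⟩
    rwa [Real.exp_neg, ← div_eq_mul_inv, div_le_iff₀ (Real.exp_pos _)] at this
  have hK0 : 0 ≤ (1 + A + 1) / (1 - q) := div_nonneg (by positivity) (by linarith)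
  constructor
  · intro t ht
    have h1 := hybound t _ (div_nonneg (by positivity) (by linarith)) (hxbound t) t ht le_rfl
    have h9 : 1 ≤ Real.exp (Γ * (t - t₀)) :=
      Real.one_le_exp (mul_nonneg hΓ.le (sub_nonneg.2 ht))
    have h10 := le_mul_of_one_le_right (by positivity : 0 ≤ (1 + A) * Φ) h9
    have h11 : B / Γ * (Φ + (1 + A + 1) * Φ / (1 - q)) * Real.exp (Γ * (t - t₀)) ≤
        1 * ((1 + (1 + A + 1) / (1 - q)) * Φ) * Real.exp (Γ * (t - t₀)) := by
      have e : Φ + (1 + A + 1) * Φ / (1 - q) = (1 + (1 + A + 1) / (1 - q)) * Φ := by ring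
      rw [e]
      gcongr
      linarith
    linarith
  · have := ae_all_iff.2 fun n : ℕ => hxbound n
    filter_upwards [this] with t ht h1
    obtain ⟨n, hn⟩ := exists_nat_ge t
    refine (ht n h1 hn).trans ?_
    rw [mul_div_right_comm]
    gcongr
    linarith

/-! ### Decay for perturbed non-oscillatory equations -/

/-- Bounds for the coefficients and delays from time `T₀` on. -/
structure CoefficientBounds (a b g h : ℝ → ℝ) (T₀ α B δ τ : ℝ) : Prop where
  nonneg : 0 ≤ T₀
  delayed_g : IsDelayedArgument g
  delayed_h : IsDelayedArgument h
  bound_nonneg_a : 0 ≤ α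
  bound_nonneg_b : 0 ≤ B
  delay_nonneg_g : 0 ≤ δ
  delay_nonneg_h : 0 ≤ τ
  bound_a : ∀ᵐ u, T₀ ≤ u → |a u| ≤ α
  bound_b : ∀ᵐ u, T₀ ≤ u → |b u| ≤ B
  delay_g : ∀ u, T₀ ≤ u → u - g u ≤ δ
  delay_h : ∀ u, T₀ ≤ u → u - h u ≤ τ

theorem exp_neg_mul_sub_le {γ ρ s t u : ℝ} (hγ : 0 ≤ γ) (h : t - u ≤ ρ) :
    Real.exp (-γ * (u - s)) ≤ Real.exp (γ * ρ) * Real.exp (-γ * (t - s)) := by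
  rw [← Real.exp_add]
  refine Real.exp_le_exp.2 ?_
  nlinarith

/-- Exponential bounds on the neutral part control the solution. -/
theorem IsNeutralPart.abs_le_of_neutralPart_le {a b g h x y : ℝ → ℝ} {T₀ s₀ s α B δ τ γ D Y T : ℝ}
    (hxy : IsNeutralPart a b g h s₀ x y) (hc : CoefficientBounds a b g h T₀ α B δ τ)
    (hs₀ : T₀ ≤ s₀) (hs : s₀ ≤ s) (hγ : 0 ≤ γ) (hq : α * Real.exp (γ * δ) < 1)
    (hY0 : 0 ≤ Y) (hD : 0 ≤ D)
    (hpast : ∀ᵐ u, u ≤ s → |x u| ≤ D)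
    (hY : ∀ u, s₀ ≤ u → u ≤ T → |y u| ≤ Y * Real.exp (-γ * (u - s))) :
    ∀ᵐ u, u ≤ T →
      |x u| ≤ (D + Y) / (1 - α * Real.exp (γ * δ)) * Real.exp (-γ * (u - s)) := by
  have hα := hc.bound_nonneg_a
  have hconv : ∀ X N u : ℝ, X * Real.exp (γ * (u - s)) ≤ N ↔ X ≤ N * Real.exp (-γ * (u - s)) := by
    intro X N u
    rw [neg_mul, Real.exp_neg, ← div_eq_mul_inv, le_div_iff₀ (Real.exp_pos _)]
  have hpast' : ∀ u, u ≤ s → |x u| ≤ D → |x u| * Real.exp (γ * (u - s)) ≤ D := by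
    intro u hu h1
    refine (mul_le_of_le_one_right (abs_nonneg _) (Real.exp_le_one_iff.2 ?_)).trans h1
    exact mul_nonpos_of_nonneg_of_nonpos hγ (by linarith)
  -- Before s the weighted |x| is at most D; after s it is at most Y plus α e^{γδ} times the
  -- previous bound, since looking back by δ costs a factor e^{γδ}.
  have key := Filter.Eventually.le_div_of_contraction
    (L := ae (volume.restrict (Iic T))) (f := fun u => |x u| * Real.exp (γ * (u - s)))
    (A := D + Y) (q := α * Real.exp (γ * δ)) (by positivity) (by positivity) hq (by
      obtain ⟨C, hC⟩ := hxy.locally_bounded T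
      refine ⟨D + |C| * Real.exp (γ * (T - s)), (ae_restrict_iff' measurableSet_Iic).2 ?_⟩
      filter_upwards [hC, hpast] with u hu hp hm
      rcases le_total u s with h1 | h1
      · have := hpast' u h1 (hp h1)
        have : 0 ≤ |C| * Real.exp (γ * (T - s)) := by positivity
        linarith
      · have h2 := (hu (hs.trans h1) hm).trans (le_abs_self C)
        have h3 : |x u| * Real.exp (γ * (u - s)) ≤ |C| * Real.exp (γ * (T - s)) := by
          gcongr
          exact hm
        linarith)
    (by
      intro N hN hf
      have hf' := (ae_restrict_iff' measurableSet_Iic).1 hf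
      refine (ae_restrict_iff' measurableSet_Iic).2 ?_
      filter_upwards [hc.delayed_g.ae_comp hf', hxy.eq_sub, hc.bound_a, hpast]
        with u h1 h2 h3 h4 hm
      have hN' : 0 ≤ α * Real.exp (γ * δ) * N := by positivity
      rcases le_total u s with h5 | h5
      · have := hpast' u h5 (h4 h5)
        linarith
      · have hu0 := hs.trans h5
        have hT0 := hs₀.trans hu0
        have hgu := hc.delayed_g.le_self u (hc.nonneg.trans hT0)
        have h6 := (hconv _ _ _).1 (h1 (hc.nonneg.trans hT0) (hgu.trans hm))
        have h7 : x u = y u + a u * x (g u) := by rw [h2 hu0]; ring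
        have h8 : |x u| ≤ |y u| + |a u| * |x (g u)| := by
          rw [h7, ← abs_mul]; exact abs_add_le _ _
        have h9 : |a u| * |x (g u)| ≤
            α * (N * (Real.exp (γ * δ) * Real.exp (-γ * (u - s)))) := by
          gcongr
          · exact h3 hT0
          · refine h6.trans ?_
            gcongr
            exact exp_neg_mul_sub_le hγ (hc.delay_g u hT0)
        have h10 := hY u hu0 hm
        refine (hconv _ _ _).2 ?_
        have h11 : 0 ≤ D * Real.exp (-γ * (u - s)) := by positivity
        linarith)
  filter_upwards [(ae_restrict_iff' measurableSet_Iic).1 key] with u hu hm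
  exact (hconv _ _ _).1 (hu hm)

/-- Exponential estimate for the solutions of a neutral equation whose neutral part satisfies a
small perturbation of a non-oscillatory delay equation. -/
theorem exists_exp_bound_of_perturbation {a b g h c r : ℝ → ℝ} {T₀ α B δ τ σ ρ l γ p m c₀ : ℝ}
    (hc : CoefficientBounds a b g h T₀ α B δ τ) (hσ : 0 ≤ σ) (hσρ : σ ≤ ρ)
    (hγ : 0 ≤ γ) (hγl : γ < l) (hc₀ : 0 < c₀) (hp : 0 ≤ p) (hm : 0 ≤ m)
    (hq : α * Real.exp (γ * δ) < 1)
    (hpm : p + m / (1 - α * Real.exp (γ * δ)) < 1 - γ / c₀)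
    (hr : ∀ᵐ t, T₀ ≤ t → t - σ ≤ r t ∧ r t ≤ t ∧ c₀ ≤ c t ∧ c t * Real.exp (l * σ) ≤ l)
    (hpert : ∀ x y s₀ s, IsNeutralPart a b g h s₀ x y → T₀ ≤ s₀ → s₀ + ρ ≤ s → ∀ T Y N,
      0 ≤ Y → 0 ≤ N → (∀ u, s₀ ≤ u → u ≤ T → |y u| ≤ Y * Real.exp (-γ * (u - s))) →
      (∀ᵐ u, u ≤ T → |x u| ≤ N * Real.exp (-γ * (u - s))) →
      ∀ᵐ t, s ≤ t → t ≤ T → |-(b t * x (h t)) + c t * y (r t)| ≤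
        c t * ((p * Y + m * N) * Real.exp (-γ * (t - s)))) :
    ∃ K, ∀ x y s₀ s D, IsNeutralPart a b g h s₀ x y → T₀ ≤ s₀ → s₀ + ρ ≤ s →
      (∀ᵐ u, u ≤ s → |x u| ≤ D) → (∀ u, s₀ ≤ u → u ≤ s → |y u| ≤ D) →
      ∀ᵐ t, s ≤ t → |x t| ≤ K * D * Real.exp (-γ * (t - s)) := by
  have hα := hc.bound_nonneg_a
  have hB := hc.bound_nonneg_b
  set q := α * Real.exp (γ * δ) with hqdef
  -- θ is the margin left by decay: c θ ≤ c - γ when c ≥ c₀. C₁ makes the comparison hold on the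
  -- history interval, where |y'| + l|y| ≤ (B + l) D. Q is the gain from y back to y, and A D
  -- collects the contribution of the past.
  set θ := 1 - γ / c₀ with hθdef
  set C₁ := 1 + (B + l) / (l - γ) with hC₁def
  have hq' : 0 < 1 - q := by linarith
  have hlγ : 0 < l - γ := by linarith
  have hl : 0 ≤ l := hγ.trans hγl.le
  have hmq : 0 ≤ m / (1 - q) := by positivity
  have hθ : 0 < θ := by linarith
  have hC₁ : 1 ≤ C₁ := by
    have : 0 ≤ (B + l) / (l - γ) := by positivity
    linarith
  have hC₁' : B + l ≤ (l - γ) * C₁ := by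
    have : (l - γ) * C₁ = (l - γ) + (B + l) := by rw [hC₁def]; field_simp
    linarith
  set Q := (p + m / (1 - q)) / θ with hQdef
  have hQ0 : 0 ≤ Q := by positivity
  have hQ1 : Q < 1 := (div_lt_one hθ).2 hpm
  set A := m / (1 - q) / θ + C₁ with hAdef
  have hA0 : 0 ≤ A := by positivity
  refine ⟨(1 + A / (1 - Q)) / (1 - q), ?_⟩
  intro x y s₀ s D hxy hs₀ hs hxD hyD
  have hρ : 0 ≤ ρ := hσ.trans hσρ
  have hs' : s₀ ≤ s := by linarith
  have hD : 0 ≤ D := (abs_nonneg _).trans (hyD s₀ le_rfl hs')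
  have main : ∀ T, s ≤ T →
      ∀ u, s₀ ≤ u → u ≤ T → |y u| ≤ A * D / (1 - Q) * Real.exp (-γ * (u - s)) := by
    intro T hT
    have hconv : ∀ X N u : ℝ,
        X * Real.exp (γ * (u - s)) ≤ N ↔ X ≤ N * Real.exp (-γ * (u - s)) := by
      intro X N u
      rw [neg_mul, Real.exp_neg, ← div_eq_mul_inv, le_div_iff₀ (Real.exp_pos _)]
    have key := Filter.Eventually.le_div_of_contraction
      (L := 𝓟 (Icc s₀ T)) (f := fun u => |y u| * Real.exp (γ * (u - s)))
      (A := A * D) (q := Q) (by positivity) hQ0 hQ1 (by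
        obtain ⟨C, hC⟩ := (hxy.absolutelyContinuous T (hs'.trans hT)).exists_bound
        rw [uIcc_of_le (hs'.trans hT)] at hC
        refine ⟨C * Real.exp (γ * (T - s)), fun u hu => ?_⟩
        have h1 := hC u hu
        have hC0 := (norm_nonneg _).trans h1
        rw [Real.norm_eq_abs] at h1
        have h2 := hu.2
        show |y u| * Real.exp (γ * (u - s)) ≤ _
        gcongr)
      (by
        intro Y hY0 hY
        have hY' : ∀ u, s₀ ≤ u → u ≤ T → |y u| ≤ Y * Real.exp (-γ * (u - s)) :=
          fun u h1 h2 => (hconv _ _ _).1 (hY ⟨h1, h2⟩)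
        set N := (D + Y) / (1 - q) with hNdef
        have hN0 : 0 ≤ N := by positivity
        have hN : ∀ᵐ u, u ≤ T → |x u| ≤ N * Real.exp (-γ * (u - s)) :=
          hxy.abs_le_of_neutralPart_le hc hs₀ hs' hγ hq hY0 hD hxD hY'
        have hpt := hpert x y s₀ s hxy hs₀ hs T Y N hY0 hN0 hY' hN
        -- The improved bound A D + Q Y is chosen so that its margin pays for the forcing p Y + m N,
        -- with C₁ D left over for the history.
        have hEθ : θ * (A * D + Q * Y) = p * Y + m * N + θ * (C₁ * D) := by
          rw [hAdef, hQdef, hNdef]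
          field_simp
          ring
        have hE0 : 0 ≤ A * D + Q * Y := by positivity
        have hED : C₁ * D ≤ A * D + Q * Y := by
          have h1 : 0 ≤ m / (1 - q) / θ * D := by positivity
          have h2 : 0 ≤ Q * Y := by positivity
          have : A * D = m / (1 - q) / θ * D + C₁ * D := by rw [hAdef]; ring
          linarith
        have hDE : D ≤ A * D + Q * Y := (le_mul_of_one_le_left hD hC₁).trans hED
        have hexp : ∀ u, u ≤ s → 1 ≤ Real.exp (-γ * (u - s)) := fun u hu =>
          Real.one_le_exp (mul_nonneg_of_nonpos_of_nonpos (by linarith) (by linarith))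
        intro u hu
        show |y u| * Real.exp (γ * (u - s)) ≤ _
        rw [hconv]
        rcases le_total u (s - σ) with hus | hus
        · have hu' : u ≤ s := by linarith
          exact (hyD u hu.1 hu').trans (hDE.trans (le_mul_of_one_le_right hE0 (hexp u hu')))
        · refine delay_equation_abs_le_exp (r := r) (c := c) (T := T) hl hσ hγ hE0
            ((hxy.absolutelyContinuous T (hs'.trans hT)).mono_Icc (by linarith) (by linarith)
              le_rfl) ((hyD _ (by linarith) (by linarith)).trans hDE) ?_ ?_ hus hu.2
          · filter_upwards [hxy.hasDerivAt, hc.delayed_h.ae_comp hxD, hc.bound_b]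
              with t h1 h2 h3 ht1 ht2
            have ht0 : s₀ ≤ t := by linarith
            have htT := hs₀.trans ht0
            have ht00 := hc.nonneg.trans htT
            refine ⟨_, h1 ht0, ?_⟩
            rw [abs_neg, abs_mul]
            calc |b t| * |x (h t)| + l * |y t| ≤ B * D + l * D := by
                  gcongr
                  · exact h3 htT
                  · exact h2 ht00 ((hc.delayed_h.le_self t ht00).trans ht2)
                  · exact hyD t ht0 ht2
              _ = (B + l) * D := by ring
              _ ≤ ((l - γ) * C₁) * D := by gcongr
              _ = (l - γ) * (C₁ * D) := by ring
              _ ≤ (l - γ) * ((A * D + Q * Y) * Real.exp (-γ * (t - s))) := by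
                  refine mul_le_mul_of_nonneg_left ?_ hlγ.le
                  exact hED.trans (le_mul_of_one_le_right hE0 (hexp t ht2))
          · filter_upwards [hxy.hasDerivAt, hr, hpt] with t h1 h2 h3 ht1 ht2
            have ht0 : s₀ ≤ t := by linarith
            obtain ⟨hr1, hr2, hc1, hc2⟩ := h2 (hs₀.trans ht0)
            refine ⟨_, h1 ht0, hr1, hr2, hc₀.le.trans hc1, hc2, (h3 ht1 ht2).trans ?_⟩
            have h4 : c t * θ ≤ c t - γ := by
              have : γ / c₀ * c₀ ≤ γ / c₀ * c t := by gcongr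
              rw [div_mul_cancel₀ _ hc₀.ne'] at this
              rw [hθdef]
              linarith
            have hct := hc₀.le.trans hc1
            have h5 : p * Y + m * N ≤ θ * (A * D + Q * Y) := by
              rw [hEθ]
              have : 0 ≤ θ * (C₁ * D) := by positivity
              linarith
            calc c t * ((p * Y + m * N) * Real.exp (-γ * (t - s)))
                ≤ c t * ((θ * (A * D + Q * Y)) * Real.exp (-γ * (t - s))) := by gcongr
              _ = (c t * θ) * ((A * D + Q * Y) * Real.exp (-γ * (t - s))) := by ring
              _ ≤ _ := by gcongr)
    intro u h1 h2
    exact (hconv _ _ _).1 (key (a := u) ⟨h1, h2⟩)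
  have hfin : ∀ T, s ≤ T → ∀ᵐ u, u ≤ T →
      |x u| ≤ (1 + A / (1 - Q)) / (1 - q) * D * Real.exp (-γ * (u - s)) := by
    intro T hT
    have hQ' : 0 < 1 - Q := by linarith
    have := hxy.abs_le_of_neutralPart_le hc hs₀ hs' hγ hq (by positivity) hD hxD (main T hT)
    filter_upwards [this] with u hu hu1
    refine (hu hu1).trans (le_of_eq ?_)
    ring
  filter_upwards [ae_all_iff.2 fun n : ℕ => hfin (s + n) (by simp)] with t ht hst
  obtain ⟨n, hn⟩ := exists_nat_ge (t - s)
  exact ht n (by linarith)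

/-! ### Forcing estimates for the two criteria -/

/-- Perturbation estimate when `b` is compared with a smaller coefficient `β`. -/
theorem perturbation_le_of_coefficient {a b g h β x y : ℝ → ℝ} {T₀ s₀ s α B δ τ γ p m Y N T : ℝ}
    (hc : CoefficientBounds a b g h T₀ α B δ τ) (hγ : 0 ≤ γ)
    (hp : 0 ≤ p) (hm : 0 ≤ m)
    (hβ : ∀ᵐ t, T₀ ≤ t → 0 ≤ β t ∧ |b t - β t| ≤ p * β t ∧ |b t| ≤ m * β t)
    (hxy : IsNeutralPart a b g h s₀ x y) (hs₀ : T₀ ≤ s₀) (hs : s₀ + τ ≤ s)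
    (hY0 : 0 ≤ Y) (hN0 : 0 ≤ N)
    (hY : ∀ u, s₀ ≤ u → u ≤ T → |y u| ≤ Y * Real.exp (-γ * (u - s)))
    (hN : ∀ᵐ u, u ≤ T → |x u| ≤ N * Real.exp (-γ * (u - s))) :
    ∀ᵐ t, s ≤ t → t ≤ T → |-(b t * x (h t)) + β t * y (h t)| ≤
      β t * ((p * Real.exp (γ * τ) * Y + m * α * Real.exp (γ * (τ + δ)) * N) *
        Real.exp (-γ * (t - s))) := by
  have hα := hc.bound_nonneg_a
  have hxg := hc.delayed_h.ae_comp (hc.delayed_g.ae_comp hN)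
  filter_upwards [hβ, hxg, hc.delayed_h.ae_comp hxy.eq_sub, hc.delayed_h.ae_comp hc.bound_a]
    with t h1 h2 h3 h4 ht1 ht2
  have ht0 : s₀ ≤ t := by linarith [hc.delay_nonneg_h]
  have htT := hs₀.trans ht0
  have ht00 := hc.nonneg.trans htT
  have hd := hc.delay_h t htT
  have hh0 : s₀ ≤ h t := by linarith
  have hhT := hs₀.trans hh0
  have hh00 := hc.nonneg.trans hhT
  have hht := hc.delayed_h.le_self t ht00
  have hgt := hc.delayed_g.le_self _ hh00
  have hdg := hc.delay_g _ hhT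
  obtain ⟨hβ0, hβ1, hβ2⟩ := h1 htT
  have e1 : |y (h t)| ≤ Y * (Real.exp (γ * τ) * Real.exp (-γ * (t - s))) := by
    refine (hY _ hh0 (hht.trans ht2)).trans ?_
    gcongr
    exact exp_neg_mul_sub_le hγ hd
  have e2 : |x (g (h t))| ≤ N * (Real.exp (γ * (τ + δ)) * Real.exp (-γ * (t - s))) := by
    refine (h2 ht00 hh00 (hgt.trans (hht.trans ht2))).trans ?_
    gcongr
    exact exp_neg_mul_sub_le hγ (by linarith)
  have e3 : -(b t * x (h t)) + β t * y (h t) =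
      -((b t - β t) * y (h t) + b t * (a (h t) * x (g (h t)))) := by
    rw [h3 ht00 hh0]; ring
  rw [e3, abs_neg]
  calc _ ≤ |(b t - β t) * y (h t)| + |b t * (a (h t) * x (g (h t)))| := abs_add_le _ _
    _ = |b t - β t| * |y (h t)| + |b t| * (|a (h t)| * |x (g (h t))|) := by
      simp only [abs_mul]
    _ ≤ (p * β t) * (Y * (Real.exp (γ * τ) * Real.exp (-γ * (t - s)))) + (m * β t) *
        (α * (N * (Real.exp (γ * (τ + δ)) * Real.exp (-γ * (t - s))))) := by
      gcongr
      exact h4 ht00 hhT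
    _ = _ := by ring

/-- Perturbation estimate when the delayed argument `h` is truncated to `max (h t) (t - σ)`. -/
theorem perturbation_le_of_truncation {a b g h x y : ℝ → ℝ} {T₀ s₀ s α B δ τ σ γ κ Y N T : ℝ}
    (hc : CoefficientBounds a b g h T₀ α B δ τ) (hγ : 0 ≤ γ) (hσ : 0 ≤ σ)
    (hb : ∀ᵐ t, T₀ ≤ t → 0 ≤ b t)
    (hκ : ∀ᵐ t, T₀ ≤ t → max (t - h t - σ) 0 ≤ κ)
    (hxy : IsNeutralPart a b g h s₀ x y) (hs₀ : T₀ ≤ s₀) (hs : s₀ + τ ≤ s)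
    (hN0 : 0 ≤ N)
    (hN : ∀ᵐ u, u ≤ T → |x u| ≤ N * Real.exp (-γ * (u - s))) :
    ∀ᵐ t, s ≤ t → t ≤ T → |-(b t * x (h t)) + b t * y (max (h t) (t - σ))| ≤
      b t * ((0 * Y + (κ * B * Real.exp (γ * (2 * τ)) + α * Real.exp (γ * (τ + δ))) * N) *
        Real.exp (-γ * (t - s))) := by
  have hα := hc.bound_nonneg_a
  have hB := hc.bound_nonneg_b
  have hxg := hc.delayed_h.ae_comp (hc.delayed_g.ae_comp hN)
  filter_upwards [hb, hκ, hxg, hc.delayed_h.ae_comp hxy.eq_sub, hc.delayed_h.ae_comp hc.bound_a]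
    with t hb0 h1 h2 h3 h4 ht1 ht2
  have ht0 : s₀ ≤ t := by linarith [hc.delay_nonneg_h]
  have htT := hs₀.trans ht0
  have ht00 := hc.nonneg.trans htT
  have hd := hc.delay_h t htT
  have hh0 : s₀ ≤ h t := by linarith
  have hhT := hs₀.trans hh0
  have hh00 := hc.nonneg.trans hhT
  have hht := hc.delayed_h.le_self t ht00
  have hgt := hc.delayed_g.le_self _ hh00
  have hdg := hc.delay_g _ hhT
  have hbt := hb0 htT
  have hrt : max (h t) (t - σ) ≤ t := max_le hht (by linarith)
  have hrh : h t ≤ max (h t) (t - σ) := le_max_left _ _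
  have hrκ : max (h t) (t - σ) - h t ≤ κ := by
    have := h1 htT
    rw [max_comm, ← max_sub_sub_right, sub_self]
    refine le_trans (le_of_eq ?_) this
    congr 1
    ring
  set L := B * (N * (Real.exp (γ * (2 * τ)) * Real.exp (-γ * (t - s)))) with hL
  have hL0 : 0 ≤ L := by positivity
  -- Integrating |y'| ≤ B |x(h)| over an interval of length at most κ; its points lie within τ of t,
  -- and h looks back by another τ, whence e^{2γτ}.
  have e1 : |y (max (h t) (t - σ)) - y (h t)| ≤ L * κ := by
    have := ((hxy.absolutelyContinuous t ht0).mono_Icc hh0 hrh hrt).abs_sub_le hrh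
      (F := fun v => L * v) (F' := fun _ => L * 1) (by fun_prop)
      (fun v => (hasDerivAt_id v).const_mul L) (by
        filter_upwards [hxy.hasDerivAt, hc.delayed_h.ae_comp hN, hc.bound_b] with u k1 k2 k3 hu1 hu2
        have hu0 := hh0.trans hu1
        have huT := hs₀.trans hu0
        have hu00 := hc.nonneg.trans huT
        have hhu := hc.delayed_h.le_self u hu00
        refine ⟨_, k1 hu0, ?_⟩
        rw [abs_neg, abs_mul, mul_one]
        refine mul_le_mul (k3 huT) ((k2 hu00 (hhu.trans (hu2.trans (hrt.trans ht2)))).trans ?_)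
          (abs_nonneg _) hB
        gcongr
        exact exp_neg_mul_sub_le hγ (by linarith [hc.delay_h u huT]))
    refine this.trans ?_
    rw [← mul_sub]
    gcongr
  have e2 : |x (g (h t))| ≤ N * (Real.exp (γ * (τ + δ)) * Real.exp (-γ * (t - s))) := by
    refine (h2 ht00 hh00 (hgt.trans (hht.trans ht2))).trans ?_
    gcongr
    exact exp_neg_mul_sub_le hγ (by linarith)
  have e3 : -(b t * x (h t)) + b t * y (max (h t) (t - σ)) =
      b t * ((y (max (h t) (t - σ)) - y (h t)) - a (h t) * x (g (h t))) := by
    rw [h3 ht00 hh0]; ring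
  rw [e3, abs_mul, abs_of_nonneg hbt]
  refine mul_le_mul_of_nonneg_left ?_ hbt
  calc _ ≤ |y (max (h t) (t - σ)) - y (h t)| + |a (h t) * x (g (h t))| := abs_sub _ _
    _ = |y (max (h t) (t - σ)) - y (h t)| + |a (h t)| * |x (g (h t))| := by rw [abs_mul]
    _ ≤ L * κ + α * (N * (Real.exp (γ * (τ + δ)) * Real.exp (-γ * (t - s)))) := by
      gcongr
      exact h4 ht00 hhT
    _ = _ := by rw [hL]; ring

/-! ### From decay estimates to uniform stability -/

/-- An exponential estimate in terms of the past up to a bounded lag after `max t₀ T₀` gives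
uniform exponential stability. -/
theorem isExponentiallyStableFrom_of_exp_bound {a b g h : ℝ → ℝ} {t₁ T₀ A α B ρ γ K : ℝ}
    (ht₁ : 0 ≤ t₁) (hT₀ : t₁ ≤ T₀) (hA : ∀ t, 0 ≤ t → |a t| ≤ A)
    (hα1 : α < 1) (hα : ∀ᵐ u, t₁ ≤ u → |a u| ≤ α)
    (hB0 : 0 ≤ B) (hB : ∀ᵐ u, t₁ ≤ u → |b u| ≤ B)
    (hα0 : 0 ≤ α) (hg : IsDelayedArgument g) (hh : IsDelayedArgument h) (hρ : 0 ≤ ρ) (hγ : 0 < γ)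
    (hK : ∀ x y s₀ s D, IsNeutralPart a b g h s₀ x y → T₀ ≤ s₀ → s₀ + ρ ≤ s →
      (∀ᵐ u, u ≤ s → |x u| ≤ D) → (∀ u, s₀ ≤ u → u ≤ s → |y u| ≤ D) →
      ∀ᵐ t, s ≤ t → |x t| ≤ K * D * Real.exp (-γ * (t - s))) :
    IsExponentiallyStableFrom a b g h t₁ := by
  have hA0 : 0 ≤ A := (abs_nonneg _).trans (hA 0 le_rfl)
  -- Large enough that B/Γ < 1 - α; the summand 1 keeps Γ positive when B = 0.
  set Γ := 2 * B / (1 - α) + 1 with hΓdef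
  have hα' : 0 < 1 - α := by linarith
  have hΓ : 0 < Γ := by positivity
  have hq : B / Γ + α < 1 := by
    have : B / Γ < 1 - α := by
      rw [div_lt_iff₀ hΓ, hΓdef]
      have : (1 - α) * (2 * B / (1 - α) + 1) = 2 * B + (1 - α) := by field_simp
      linarith
    linarith
  set K₁ := 1 + A + (1 + (1 + A + 1) / (1 - (B / Γ + α))) with hK₁def
  have hK₁ : 1 ≤ K₁ := by
    have : 0 ≤ (1 + A + 1) / (1 - (B / Γ + α)) := div_nonneg (by positivity) (by linarith)
    linarith
  have hK₁0 : 0 < K₁ := by linarith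
  -- L bounds the gap from t₀ to max(t₀, T₀) + ρ for every t₀ ≥ t₁, which makes the constants
  -- uniform in t₀.
  set L := T₀ - t₁ + ρ with hLdef
  have hL : 0 ≤ L := by linarith
  refine ⟨(1 + |K|) * (K₁ * Real.exp (Γ * L)) * Real.exp (γ * L), γ, by positivity, hγ, ?_⟩
  intro t₀ ht₀ φ x hφ hx
  have ht00 := ht₁.trans ht₀
  obtain ⟨C, hC⟩ := hφ.bounded
  set Φ := ⨆ r : Iic t₀, |φ r| with hΦdef
  have hxΦ : ∀ u ≤ t₀, |x u| ≤ Φ := by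
    intro u hu
    rw [hx.initial u hu]
    exact le_ciSup (f := fun r : Iic t₀ => |φ r|)
      ⟨C, by rintro _ ⟨r, rfl⟩; exact hC r r.2⟩ ⟨u, hu⟩
  have hΦ : 0 ≤ Φ := (abs_nonneg _).trans (hxΦ t₀ le_rfl)
  obtain ⟨y, hxy, hy0⟩ := hx.exists_neutralPart ht00
  obtain ⟨hyb, hxb⟩ := hxy.growth_bound hy0 hg hh ht00 hA0 (hA t₀ ht00) hα0
    (hα.mono fun u hu h1 => hu (ht₀.trans h1)) hB0 (hB.mono fun u hu h1 => hu (ht₀.trans h1))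
    hΓ hq hxΦ
  rw [← hK₁def] at hyb hxb
  set s₀ := max t₀ T₀ with hs₀def
  have hs₀ : t₀ ≤ s₀ := le_max_left _ _
  have hsL : s₀ + ρ - t₀ ≤ L := by
    have : s₀ ≤ t₀ + (T₀ - t₁) := max_le (by linarith) (by linarith)
    linarith
  set D := K₁ * Φ * Real.exp (Γ * L) with hDdef
  have hgrow : ∀ u, u ≤ s₀ + ρ → K₁ * Φ * Real.exp (Γ * (u - t₀)) ≤ D := by
    intro u hu
    refine mul_le_mul_of_nonneg_left (Real.exp_le_exp.2 ?_) (by positivity)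
    exact mul_le_mul_of_nonneg_left (by linarith) hΓ.le
  have hΦD : Φ ≤ D := by
    refine (le_mul_of_one_le_left hΦ hK₁).trans (le_mul_of_one_le_right (by positivity) ?_)
    exact Real.one_le_exp (by positivity)
  have hD : 0 ≤ D := hΦ.trans hΦD
  have hxD : ∀ᵐ u, u ≤ s₀ + ρ → |x u| ≤ D := by
    filter_upwards [hxb] with u hu h1
    rcases le_total u t₀ with h2 | h2
    · exact (hxΦ u h2).trans hΦD
    · exact (hu h2).trans (hgrow u h1)
  have hdecay := hK x y s₀ (s₀ + ρ) D (hxy.mono hs₀) (le_max_right _ _) le_rfl hxD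
    fun u h1 h2 => (hyb u (hs₀.trans h1)).trans (hgrow u h2)
  refine (ae_restrict_iff' measurableSet_Ici).2 ?_
  filter_upwards [hdecay, hxD] with t h1 h2 ht
  have ht : t₀ ≤ t := ht
  have key : |x t| ≤ (1 + |K|) * D * Real.exp (-γ * (t - (s₀ + ρ))) := by
    rcases le_total t (s₀ + ρ) with h3 | h3
    · have h4 : 1 ≤ Real.exp (-γ * (t - (s₀ + ρ))) :=
        Real.one_le_exp (mul_nonneg_of_nonpos_of_nonpos (by linarith) (by linarith))
      have h5 : D ≤ (1 + |K|) * D := le_mul_of_one_le_left hD (by linarith [abs_nonneg K])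
      exact (h2 h3).trans (h5.trans (le_mul_of_one_le_right (hD.trans h5) h4))
    · refine (h1 h3).trans ?_
      gcongr
      linarith [le_abs_self K]
  refine key.trans ?_
  have h6 : Real.exp (-γ * (t - (s₀ + ρ))) ≤ Real.exp (γ * L) * Real.exp (-γ * (t - t₀)) := by
    rw [← Real.exp_add]
    refine Real.exp_le_exp.2 ?_
    linarith [mul_le_mul_of_nonneg_left hsL hγ.le]
  calc _ ≤ (1 + |K|) * D * (Real.exp (γ * L) * Real.exp (-γ * (t - t₀))) := by gcongr
    _ = _ := by rw [hDdef]; ring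

/-! ### The two criteria and the conclusion -/

/-- If the smallness condition of `exists_exp_bound_of_perturbation` holds at exponent `0`, it
holds at some positive exponent. -/
theorem exists_small_exponent {α δ l c₀ : ℝ} {P m : ℝ → ℝ} (hP : Continuous P) (hm : Continuous m)
    (hα : α < 1) (hl : 0 < l) (h0 : P 0 + m 0 / (1 - α) < 1) :
    ∃ γ, 0 < γ ∧ γ < l ∧ α * Real.exp (γ * δ) < 1 ∧
      P γ + m γ / (1 - α * Real.exp (γ * δ)) < 1 - γ / c₀ := by
  have hα' : (1 : ℝ) - α * Real.exp (0 * δ) ≠ 0 := by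
    rw [zero_mul, Real.exp_zero]; linarith
  have h1 : ∀ᶠ γ in nhds (0 : ℝ), γ < l := eventually_lt_nhds hl
  have h2 : ∀ᶠ γ in nhds (0 : ℝ), α * Real.exp (γ * δ) < 1 := by
    have hc : ContinuousAt (fun γ : ℝ => α * Real.exp (γ * δ)) 0 := by fun_prop
    exact hc.eventually_lt continuousAt_const (by simpa using hα)
  have h3 : ∀ᶠ γ in nhds (0 : ℝ),
      P γ + m γ / (1 - α * Real.exp (γ * δ)) < 1 - γ / c₀ := by
    have hc : ContinuousAt (fun γ : ℝ => P γ + m γ / (1 - α * Real.exp (γ * δ))) 0 := by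
      refine hP.continuousAt.add (hm.continuousAt.div ?_ hα')
      fun_prop
    have hc' : ContinuousAt (fun γ : ℝ => 1 - γ / c₀) 0 := by fun_prop
    exact hc.eventually_lt hc' (by simpa using h0)
  have h4 : ∀ᶠ γ in nhdsWithin (0 : ℝ) (Ioi 0), 0 < γ := self_mem_nhdsWithin
  obtain ⟨γ, hγ, k1, k2, k3⟩ :=
    (h4.and (((h1.and (h2.and h3))).filter_mono nhdsWithin_le_nhds)).exists
  exact ⟨γ, hγ, k1, k2, k3⟩

/-- The stability criterion based on comparing `b` with `β = min b (1 / (τ e))`. -/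
theorem exists_exp_bound_of_coefficient {a b g h β : ℝ → ℝ} {T₀ α B δ τ b₀ : ℝ}
    (hc : CoefficientBounds a b g h T₀ α B δ τ) (hτ : 0 < τ) (hα1 : α < 1)
    (hb₀ : 0 < b₀) (hb : ∀ᵐ t, T₀ ≤ t → b₀ ≤ b t)
    (hβ : ∀ t, β t = min (b t) (1 / (τ * Real.exp 1)))
    (hcond : supNormFrom T₀ (fun t => (b t - β t) / β t)
      + supNormFrom T₀ (fun t => b t / β t) * (α / (1 - α)) < 1) :
    ∃ γ K, 0 < γ ∧ ∀ x y s₀ s D, IsNeutralPart a b g h s₀ x y → T₀ ≤ s₀ → s₀ + τ ≤ s →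
      (∀ᵐ u, u ≤ s → |x u| ≤ D) → (∀ u, s₀ ≤ u → u ≤ s → |y u| ≤ D) →
      ∀ᵐ t, s ≤ t → |x t| ≤ K * D * Real.exp (-γ * (t - s)) := by
  have hα := hc.bound_nonneg_a
  have hB := hc.bound_nonneg_b
  set p := supNormFrom T₀ (fun t => (b t - β t) / β t)
  set m := supNormFrom T₀ (fun t => b t / β t)
  set c₀ := min b₀ (1 / (τ * Real.exp 1)) with hc₀def
  have hc₀ : 0 < c₀ := lt_min hb₀ (by positivity)
  have hp0 : 0 ≤ p := supNormFrom_nonneg _ _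
  have hm0 : 0 ≤ m := supNormFrom_nonneg _ _
  have hβc : ∀ᵐ t, T₀ ≤ t → c₀ ≤ β t := by
    filter_upwards [hb] with t ht h1
    rw [hβ]
    exact min_le_min_right _ (ht h1)
  have hβb : ∀ t, β t ≤ b t := fun t => by rw [hβ]; exact min_le_left _ _
  have hp : ∀ᵐ t, T₀ ≤ t → |(b t - β t) / β t| ≤ p := by
    refine ae_abs_le_supNormFrom ⟨B / c₀, (ae_restrict_iff' measurableSet_Ici).2 ?_⟩
    filter_upwards [hβc, hc.bound_b] with t h1 h2 h3
    have k1 := h1 h3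
    have k2 := (le_abs_self _).trans (h2 h3)
    have k3 := hβb t
    rw [abs_of_nonneg (div_nonneg (by linarith) (by linarith))]
    exact div_le_div₀ hB (by linarith) hc₀ k1
  have hm : ∀ᵐ t, T₀ ≤ t → |b t / β t| ≤ m := by
    refine ae_abs_le_supNormFrom ⟨B / c₀, (ae_restrict_iff' measurableSet_Ici).2 ?_⟩
    filter_upwards [hβc, hc.bound_b] with t h1 h2 h3
    have k1 := h1 h3
    have k3 := hβb t
    rw [abs_div, abs_of_pos (by linarith : 0 < β t)]
    exact div_le_div₀ hB (h2 h3) hc₀ k1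
  have hpm : ∀ᵐ t, T₀ ≤ t → 0 ≤ β t ∧ |b t - β t| ≤ p * β t ∧ |b t| ≤ m * β t := by
    filter_upwards [hβc, hp, hm] with t h1 h2 h3 h4
    have k1 : 0 < β t := hc₀.trans_le (h1 h4)
    have k2 := h2 h4
    have k3 := h3 h4
    rw [abs_div, abs_of_pos k1, div_le_iff₀ k1] at k2 k3
    exact ⟨k1.le, k2, k3⟩
  -- The value l = 1/τ maximizes l e^{-lτ}; the maximum 1/(τe) is the cap in β.
  obtain ⟨γ, hγ, hγl, hq, hsmall⟩ := exists_small_exponent (α := α) (δ := δ) (l := 1 / τ)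
    (c₀ := c₀) (P := fun γ => p * Real.exp (γ * τ))
    (m := fun γ => m * α * Real.exp (γ * (τ + δ))) (by fun_prop) (by fun_prop) hα1
    (by positivity) (by simpa [mul_div_assoc] using hcond)
  obtain ⟨K, hK⟩ := exists_exp_bound_of_perturbation (r := h) (c := β) (σ := τ) (ρ := τ)
    hc hτ.le le_rfl hγ.le hγl hc₀ (by positivity) (by positivity) hq hsmall (by
      filter_upwards [hβc] with t h1 h2
      refine ⟨by linarith [hc.delay_h t h2], hc.delayed_h.le_self t (hc.nonneg.trans h2), h1 h2, ?_⟩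
      rw [one_div_mul_cancel hτ.ne']
      calc β t * Real.exp 1 ≤ 1 / (τ * Real.exp 1) * Real.exp 1 := by
            gcongr
            rw [hβ]
            exact min_le_right _ _
        _ = 1 / τ := by field_simp)
    (fun x y s₀ s hxy h1 h2 T Y N hY0 hN0 hY hN =>
      perturbation_le_of_coefficient hc hγ.le hp0 hm0 hpm hxy h1 h2 hY0 hN0 hY hN)
  exact ⟨γ, K, hγ, hK⟩

/-- The stability criterion based on truncating the delay at `1 / (B e)`. -/
theorem exists_exp_bound_of_truncation {a b g h : ℝ → ℝ} {T₀ α B δ τ b₀ κ : ℝ}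
    (hc : CoefficientBounds a b g h T₀ α B δ τ) (hα1 : α < 1) (hB0 : 0 < B)
    (hb₀ : 0 < b₀) (hb : ∀ᵐ t, T₀ ≤ t → b₀ ≤ b t) (hκ0 : 0 ≤ κ)
    (hκ : ∀ᵐ t, T₀ ≤ t → max (t - h t - 1 / (B * Real.exp 1)) 0 ≤ κ)
    (hcond : B * κ < 1 - 2 * α) :
    ∃ γ K, 0 < γ ∧ ∀ x y s₀ s D, IsNeutralPart a b g h s₀ x y → T₀ ≤ s₀ →
      s₀ + (τ + 1 / (B * Real.exp 1)) ≤ s →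
      (∀ᵐ u, u ≤ s → |x u| ≤ D) → (∀ u, s₀ ≤ u → u ≤ s → |y u| ≤ D) →
      ∀ᵐ t, s ≤ t → |x t| ≤ K * D * Real.exp (-γ * (t - s)) := by
  have hα := hc.bound_nonneg_a
  have hτ := hc.delay_nonneg_h
  set σ := 1 / (B * Real.exp 1) with hσdef
  have hσ : 0 < σ := by positivity
  have hα' : 0 < 1 - α := by linarith
  obtain ⟨γ, hγ, hγl, hq, hsmall⟩ := exists_small_exponent (α := α) (δ := δ)
    (l := B * Real.exp 1) (c₀ := b₀) (P := fun _ => 0)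
    (m := fun γ => κ * B * Real.exp (γ * (2 * τ)) + α * Real.exp (γ * (τ + δ)))
    (by fun_prop) (by fun_prop) hα1 (by positivity) (by
      simp only [zero_mul, Real.exp_zero, mul_one, zero_add]
      rw [div_lt_one hα']
      linarith)
  -- The lag τ keeps h t beyond s₀ for t ≥ s, and σ is the length of the history interval of the
  -- truncated equation.
  obtain ⟨K, hK⟩ := exists_exp_bound_of_perturbation (r := fun t => max (h t) (t - σ)) (c := b)
    (σ := σ) (ρ := τ + σ) hc hσ.le (by linarith) hγ.le hγl hb₀ le_rfl (by positivity) hq hsmall (by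
      filter_upwards [hb, hc.bound_b] with t h1 h2 h3
      refine ⟨le_max_right _ _, max_le (hc.delayed_h.le_self t (hc.nonneg.trans h3)) (by linarith),
        h1 h3, ?_⟩
      have : B * Real.exp 1 * σ = 1 := by rw [hσdef]; field_simp
      rw [this]
      gcongr
      exact (le_abs_self _).trans (h2 h3))
    (fun x y s₀ s hxy h1 h2 T Y N _ hN0 _ hN =>
      perturbation_le_of_truncation hc hγ.le hσ.le
        (hb.mono fun t ht h3 => hb₀.le.trans (ht h3)) hκ hxy h1 (by linarith) hN0 hN)
  exact ⟨γ, K, hγ, hK⟩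

theorem theorem2 (a b g h : ℝ → ℝ)
    (ha_meas : AEMeasurable a (volume.restrict (Set.Ici 0)))
    (ha_bdd : ∃ A : ℝ, ∀ t, 0 ≤ t → |a t| ≤ A)
    (hb_meas : AEMeasurable b (volume.restrict (Set.Ici 0)))
    (hb_bdd : ∃ B : ℝ, ∀ᵐ t ∂(volume.restrict (Set.Ici (0 : ℝ))), |b t| ≤ B)
    (t₁ : ℝ) (ht₁ : 0 ≤ t₁)
    (ha_lt : ∃ a₀ : ℝ, a₀ < 1 ∧ ∀ᵐ t ∂(volume.restrict (Set.Ici t₁)), |a t| ≤ a₀)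
    (hg : IsDelayedArgument g) (hh : IsDelayedArgument h)
    (b₀ : ℝ) (hb₀ : 0 < b₀)
    (hb : ∀ᵐ t ∂(volume.restrict (Set.Ici (0 : ℝ))), b₀ ≤ b t)
    (t₀ : ℝ) (ht₀ : t₁ ≤ t₀)
    (δ τ : ℝ) (hδ : 0 < δ) (hτ : 0 < τ)
    (hg_bdd : ∀ t, t₀ ≤ t → t - g t ≤ δ)
    (hh_bdd : ∀ t, t₀ ≤ t → t - h t ≤ τ)
    (β : ℝ → ℝ) (hβ : ∀ t, β t = min (b t) (1 / (τ * Real.exp 1)))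
    (hcond :
      supNormFrom t₀ (fun t => (b t - β t) / β t)
          + supNormFrom t₀ (fun t => b t / β t) * (supNormFrom t₀ a / (1 - supNormFrom t₀ a)) < 1
      ∨ supNormFrom t₀ b
          * supNormFrom t₀ (fun t => max (t - h t - 1 / (supNormFrom t₀ b * Real.exp 1)) 0)
        < 1 - 2 * supNormFrom t₀ a) :
    IsExponentiallyStableFrom a b g h t₁ := by
  obtain ⟨A, hA⟩ := ha_bdd
  obtain ⟨B, hB⟩ := hb_bdd
  obtain ⟨a₀, ha₀, haa⟩ := ha_lt
  have hb' := ae_of_ae_restrict_Ici hb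
  have hB' := ae_of_ae_restrict_Ici hB
  have haa' := ae_of_ae_restrict_Ici haa
  have h0 : 0 ≤ t₀ := ht₁.trans ht₀
  have hBt₀ : ∀ᵐ t ∂(volume.restrict (Ici t₀)), |b t| ≤ B :=
    (ae_restrict_iff' measurableSet_Ici).2 (hB'.mono fun t ht h1 => ht (h0.trans h1))
  have hat₀ : ∀ᵐ t ∂(volume.restrict (Ici t₀)), |a t| ≤ max a₀ 0 :=
    (ae_restrict_iff' measurableSet_Ici).2
      (haa'.mono fun t ht h1 => (ht (ht₀.trans h1)).trans (le_max_left _ _))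
  have hα1 : supNormFrom t₀ a < 1 :=
    (supNormFrom_le (le_max_right _ _) hat₀).trans_lt (max_lt ha₀ one_pos)
  have hbt₀ : ∀ᵐ t, t₀ ≤ t → b₀ ≤ b t := hb'.mono fun t ht h1 => ht (h0.trans h1)
  have hbnorm : ∀ᵐ t, t₀ ≤ t → |b t| ≤ supNormFrom t₀ b := ae_abs_le_supNormFrom ⟨B, hBt₀⟩
  have hc : CoefficientBounds a b g h t₀ (supNormFrom t₀ a) (supNormFrom t₀ b) δ τ :=
    { nonneg := h0
      delayed_g := hg
      delayed_h := hh
      bound_nonneg_a := supNormFrom_nonneg _ _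
      bound_nonneg_b := supNormFrom_nonneg _ _
      delay_nonneg_g := hδ.le
      delay_nonneg_h := hτ.le
      bound_a := ae_abs_le_supNormFrom ⟨_, hat₀⟩
      bound_b := hbnorm
      delay_g := hg_bdd
      delay_h := hh_bdd }
  have hstable : ∀ ρ, 0 ≤ ρ → (∃ γ K, 0 < γ ∧ ∀ x y s₀ s D, IsNeutralPart a b g h s₀ x y →
      t₀ ≤ s₀ → s₀ + ρ ≤ s →
      (∀ᵐ u, u ≤ s → |x u| ≤ D) → (∀ u, s₀ ≤ u → u ≤ s → |y u| ≤ D) →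
      ∀ᵐ t, s ≤ t → |x t| ≤ K * D * Real.exp (-γ * (t - s))) →
      IsExponentiallyStableFrom a b g h t₁ := by
    rintro ρ hρ ⟨γ, K, hγ, hK⟩
    -- The growth phase may start at t₁, so it uses bounds valid from there rather than the norms on
    -- [t₀, ∞).
    exact isExponentiallyStableFrom_of_exp_bound (A := A) (α := max a₀ 0) (B := max B 0) ht₁ ht₀ hA
      (max_lt ha₀ one_pos) (haa'.mono fun t ht h1 => (ht h1).trans (le_max_left _ _))
      (le_max_right _ _) (hB'.mono fun t ht h1 => (ht (ht₁.trans h1)).trans (le_max_left _ _))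
      (le_max_right _ _) hg hh hρ hγ hK
  rcases hcond with hcond | hcond
  · exact hstable τ hτ.le (exists_exp_bound_of_coefficient hc hτ hα1 hb₀ hbt₀ hβ hcond)
  · have hBpos : 0 < supNormFrom t₀ b := by
      have hpos : ∀ᵐ t ∂(volume.restrict (Ici t₀)), 0 < supNormFrom t₀ b := by
        refine (ae_restrict_iff' measurableSet_Ici).2 ?_
        filter_upwards [hbt₀, hbnorm] with t h1 h2 h3
        exact hb₀.trans_le ((h1 h3).trans ((le_abs_self _).trans (h2 h3)))
      have : NeBot (ae (volume.restrict (Ici t₀))) := by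
        rw [ae_neBot, Ne, Measure.restrict_eq_zero]
        simp
      obtain ⟨_, h1⟩ := hpos.exists
      exact h1
    refine hstable _ (by positivity) (exists_exp_bound_of_truncation hc hα1 hBpos hb₀ hbt₀
      (supNormFrom_nonneg _ _) ?_ hcond)
    have hσ : 0 ≤ 1 / (supNormFrom t₀ b * Real.exp 1) := by positivity
    have := ae_abs_le_supNormFrom (t₀ := t₀)
      (f := fun t => max (t - h t - 1 / (supNormFrom t₀ b * Real.exp 1)) 0)
      ⟨τ, (ae_restrict_iff' measurableSet_Ici).2 (ae_of_all _ fun t ht => by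
        rw [abs_of_nonneg (le_max_right _ _)]
        exact max_le (by linarith [hh_bdd t ht]) hτ.le)⟩
    exact this.mono fun t ht h1 => (le_abs_self _).trans (ht h1)
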